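/- Call a matrix $A=(a_{ij})\in\mathbb{C}^{n\times n}$ Toeplitz if its entries are constant along the diagonals, i.e. $a_{ij}=a_{i'j'}$ whenever $j-i=j'-i'$, and Hankel if its entries are constant along the reverse diagonals, i.e. $a_{ij}=a_{i'j'}$ whenever $i+j=i'+j'$. Let $r=\lfloor n/2\rfloor+1$. Then every matrix $A\in\mathbb{C}^{n\times n}$ can be written as a product $A=T_1T_2\cdots T_{4r+1}$ of $4r+1$ Toeplitz matrices $T_1,\dots,T_{4r+1}\in\mathbb{C}^{n\times n}$, and also as a product $A=H_1H_2\cdots H_{4r+1}$ of $4r+1$ Hankel matrices $H_1,\dots,H_{4r+1}\in\mathbb{C}^{n\times n}$. -/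

import Mathlib

/-- A square matrix is Toeplitz if its entries are constant along each diagonal,
i.e. the `(i, j)` entry depends only on `j - i`. -/
def IsToeplitz {n : ℕ} (A : Matrix (Fin n) (Fin n) ℂ) : Prop :=
  ∀ i j i' j' : Fin n, (j : ℤ) - (i : ℤ) = (j' : ℤ) - (i' : ℤ) → A i j = A i' j'

/-- A square matrix is Hankel if its entries are constant along each reverse diagonal,
i.e. the `(i, j)` entry depends only on `i + j`. -/
def IsHankel {n : ℕ} (A : Matrix (Fin n) (Fin n) ℂ) : Prop :=
  ∀ i j i' j' : Fin n, (i : ℕ) + (j : ℕ) = (i' : ℕ) + (j' : ℕ) → A i j = A i' j'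

/-! Put r = ⌊n/2⌋ + 1. The product map from r-tuples of Toeplitz matrices to all matrices is
polynomial, and the main point is that its derivative is onto somewhere. With S_m = `swapShift n m`,
take the factors 1 + t^m S_m for m = 1, ..., r. Differences of tangent vectors at adjacent factors,
divided by powers of t, tend to -S_m Y with Y Toeplitz as t → 0. These and the Toeplitz matrices
span everything (`eq_top_of_isToeplitz_of_swapShift`); spanning is an open condition, so it persists
for some t ≠ 0.

The product map is therefore dominant, and by Chevalley's theorem and the Nullstellensatz its image
contains a dense open set U. An invertible A lies in U · U, giving 2r factors. A general A is P D Q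
with P, Q invertible and D a Toeplitz shift of the same rank, giving 4r + 1. The exchange matrix J
turns Toeplitz products into Hankel ones. -/

/-! ### Toeplitz matrices and their swapped shifts span all matrices -/

section ToeplitzSpan

open Matrix

/-- The matrix with ones on the diagonal `j - i = d` and zeros elsewhere. -/
def shiftMatrix (n : ℕ) (d : ℤ) : Matrix (Fin n) (Fin n) ℂ :=
  Matrix.of fun i j => if (j : ℤ) - (i : ℤ) = d then 1 else 0

theorem shiftMatrix_apply {n : ℕ} (d : ℤ) (i j : Fin n) :
    shiftMatrix n d i j = if (j : ℤ) - (i : ℤ) = d then 1 else 0 := rfl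

theorem isToeplitz_shiftMatrix (n : ℕ) (d : ℤ) : IsToeplitz (shiftMatrix n d) := by
  intro i j i' j' h
  simp only [shiftMatrix_apply, h]

theorem shiftMatrix_mul_shiftMatrix_apply {n : ℕ} (p d : ℤ) (a b : Fin n) :
    (shiftMatrix n p * shiftMatrix n d) a b =
      if 0 ≤ (a : ℤ) + p ∧ (a : ℤ) + p < n ∧ (b : ℤ) - a = p + d then 1 else 0 := by
  rw [Matrix.mul_apply]
  simp only [shiftMatrix_apply]
  split_ifs with h
  · obtain ⟨h1, h2, h3⟩ := h
    rw [Finset.sum_eq_single (⟨((a : ℤ) + p).toNat, by omega⟩ : Fin n)]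
    · rw [if_pos, if_pos, one_mul] <;> simp only [Int.toNat_of_nonneg h1] <;> omega
    · intro j _ hj
      rw [if_neg, zero_mul]
      intro h
      apply hj
      ext
      simp only
      omega
    · simp
  · refine Finset.sum_eq_zero fun j _ => ?_
    have := j.2
    split_ifs <;> first | omega | simp

/-- The sum of the two shifts by `n - m` in opposite directions. -/
def swapShift (n m : ℕ) : Matrix (Fin n) (Fin n) ℂ :=
  shiftMatrix n ((n : ℤ) - m) + shiftMatrix n ((m : ℤ) - n)

theorem isToeplitz_swapShift (n m : ℕ) : IsToeplitz (swapShift n m) := by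
  intro i j i' j' h
  simp only [swapShift, Matrix.add_apply, shiftMatrix_apply, h]

/-- For 2m ≤ n, the first m rows of S_m Y are the last m rows of Y, its last m rows are the first m
rows of Y, and all others vanish. Induction on m works modulo the outer rows already obtained, so
each step only has to produce the matrix units of one new row at the top and one at the bottom. -/
theorem mem_of_rows_of_swapShift {n : ℕ} (W : Submodule ℂ (Matrix (Fin n) (Fin n) ℂ))
    (h0 : ∀ Y, IsToeplitz Y → Y ∈ W)
    (h1 : ∀ m, 1 ≤ m → 2 * m ≤ n → ∀ Y, IsToeplitz Y → swapShift n m * Y ∈ W)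
    (m : ℕ) (hm : 2 * m ≤ n) (M : Matrix (Fin n) (Fin n) ℂ)
    (hM : ∀ a b : Fin n, ¬((a : ℕ) < m ∨ n ≤ a + m) → M a b = 0) : M ∈ W := by
  induction m generalizing M with
  | zero =>
    have : M = 0 := by
      ext a b
      exact hM a b (by omega)
    rw [this]
    exact W.zero_mem
  | succ m ih =>
    have ih := ih (by omega)
    have hn : 0 < n := by omega
    have key : ∀ d : ℤ, ∀ N : Matrix (Fin n) (Fin n) ℂ,
        (∀ a b : Fin n, ¬((a : ℕ) < m ∨ n ≤ a + m) →
          (swapShift n (m + 1) * shiftMatrix n d) a b = N a b) → N ∈ W := by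
      intro d N hN
      have := ih (swapShift n (m + 1) * shiftMatrix n d - N) (fun a b hab => by
        rw [Matrix.sub_apply, hN a b hab, sub_self])
      exact (W.sub_mem_iff_right (h1 _ (by omega) hm _ (isToeplitz_shiftMatrix n d))).1 this
    have top : ∀ a b : Fin n, (a : ℕ) = m → (b : ℕ) + 1 < n → Matrix.single a b (1 : ℂ) ∈ W := by
      intro a b ha hb
      -- The new top row is the last row of the shift and the new bottom row is its first row. A
      -- negative d makes the first row vanish; a positive one, used for `bot`, makes the last row
      -- vanish.
      refine key ((b : ℤ) + 1 - n) _ fun x y hxy => ?_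
      simp only [swapShift, add_mul, Matrix.add_apply, shiftMatrix_mul_shiftMatrix_apply,
        Matrix.single_apply, Fin.ext_iff]
      have := x.2
      have := y.2
      split_ifs <;> first | omega | simp
    have bot : ∀ a b : Fin n, (a : ℕ) + m + 1 = n → 0 < (b : ℕ) →
        Matrix.single a b (1 : ℂ) ∈ W := by
      intro a b ha hb
      refine key (b : ℤ) _ fun x y hxy => ?_
      simp only [swapShift, add_mul, Matrix.add_apply, shiftMatrix_mul_shiftMatrix_apply,
        Matrix.single_apply, Fin.ext_iff]
      have := x.2
      have := y.2
      split_ifs <;> first | omega | simp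
    have topLast : ∀ a b : Fin n, (a : ℕ) = m → (b : ℕ) + 1 = n →
        Matrix.single a b (1 : ℂ) ∈ W := by
      intro a b ha hb
      -- The corner entry missed by `top` comes from a Toeplitz matrix whose diagonal ends at row m,
      -- in the last column.
      have := ih (shiftMatrix n ((n : ℤ) - m - 1) - Matrix.single a b 1) (fun x y hxy => by
        simp only [Matrix.sub_apply, shiftMatrix_apply, Matrix.single_apply, Fin.ext_iff]
        have := x.2
        have := y.2
        split_ifs <;> first | omega | simp)
      exact (W.sub_mem_iff_right (h0 _ (isToeplitz_shiftMatrix n _))).1 this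
    have botFirst : ∀ a b : Fin n, (a : ℕ) + m + 1 = n → (b : ℕ) = 0 →
        Matrix.single a b (1 : ℂ) ∈ W := by
      intro a b ha hb
      -- For d = 0 both new rows contribute one entry; the top one is already known to lie in `W`.
      have := key 0 (Matrix.single (⟨m, by omega⟩ : Fin n) (⟨n - 1, by omega⟩ : Fin n) 1 +
        Matrix.single a b 1) (fun x y hxy => by
          simp only [swapShift, add_mul, Matrix.add_apply, shiftMatrix_mul_shiftMatrix_apply,
            Matrix.single_apply, Fin.ext_iff]
          have := x.2
          have := y.2
          split_ifs <;> first | omega | simp)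
      refine (W.add_mem_iff_right (topLast _ _ rfl ?_)).1 this
      simp only
      omega
    rw [Matrix.matrix_eq_sum_single M]
    refine W.sum_mem fun a _ => W.sum_mem fun b _ => ?_
    by_cases hab : (a : ℕ) < m ∨ n ≤ a + m
    · refine ih _ fun x y hxy => ?_
      rw [Matrix.single_apply, if_neg]
      rintro ⟨rfl, rfl⟩
      exact hxy hab
    by_cases hab' : (a : ℕ) < m + 1 ∨ n ≤ a + (m + 1)
    · have : Matrix.single a b (1 : ℂ) ∈ W := by
        have := b.2
        by_cases ha : (a : ℕ) = m
        · by_cases hb : (b : ℕ) + 1 < n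
          · exact top a b ha hb
          · exact topLast a b ha (by omega)
        · by_cases hb : 0 < (b : ℕ)
          · exact bot a b (by omega) hb
          · exact botFirst a b (by omega) (by omega)
      simpa [Matrix.smul_single] using W.smul_mem (M a b) this
    · rw [hM a b hab', Matrix.single_zero]
      exact W.zero_mem

theorem eq_top_of_isToeplitz_of_swapShift {n : ℕ} (W : Submodule ℂ (Matrix (Fin n) (Fin n) ℂ))
    (h0 : ∀ Y, IsToeplitz Y → Y ∈ W)
    (h1 : ∀ m, 1 ≤ m → 2 * m ≤ n → ∀ Y, IsToeplitz Y → swapShift n m * Y ∈ W) : W = ⊤ := by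
  have ih := mem_of_rows_of_swapShift W h0 h1 (n / 2) (by omega)
  rw [Submodule.eq_top_iff']
  intro M
  rw [Matrix.matrix_eq_sum_single M]
  refine W.sum_mem fun a _ => W.sum_mem fun b _ => ?_
  by_cases hab : (a : ℕ) < n / 2 ∨ n ≤ a + n / 2
  · refine ih _ fun x y hxy => ?_
    rw [Matrix.single_apply, if_neg]
    rintro ⟨rfl, rfl⟩
    exact hxy hab
  -- Only the middle row for odd n is left; modulo the other rows, a shift has a single entry there.
  · have : Matrix.single a b (1 : ℂ) ∈ W := by
      have := ih (shiftMatrix n ((b : ℤ) - a) - Matrix.single a b 1) (fun x y hxy => by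
        simp only [Matrix.sub_apply, shiftMatrix_apply, Matrix.single_apply, Fin.ext_iff]
        have := x.2
        split_ifs <;> first | omega | simp)
      exact (W.sub_mem_iff_right (h0 _ (isToeplitz_shiftMatrix n _))).1 this
    simpa [Matrix.smul_single] using W.smul_mem (M a b) this

end ToeplitzSpan

/-! ### Surjectivity of the derivative of the product -/

section ProductTangent

open Filter Topology

/-- A basis extracted from the family at `t₀` stays linearly independent nearby, hence stays a basis
by dimension. -/
theorem eventually_span_eq_top {E κ T : Type*} [NormedAddCommGroup E] [NormedSpace ℂ E]
    [FiniteDimensional ℂ E] [TopologicalSpace T] {t₀ : T} (v : T → κ → E)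
    (hv : ∀ k, Continuous fun t => v t k) (h : Submodule.span ℂ (Set.range (v t₀)) = ⊤) :
    ∀ᶠ t in 𝓝 t₀, Submodule.span ℂ (Set.range (v t)) = ⊤ := by
  obtain ⟨b, hb, hspan, hli⟩ := exists_linearIndependent ℂ (Set.range (v t₀))
  rw [h] at hspan
  have hfin : Finite b := hli.finite
  have hfin' : Fintype b := Fintype.ofFinite b
  choose g hg using fun x : b => hb x.2
  have hli' : LinearIndependent ℂ (fun x : b => v t₀ (g x)) := by
    simpa only [hg] using hli
  have hcard : Fintype.card b = Module.finrank ℂ E := by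
    have := finrank_span_eq_card hli
    rw [Subtype.range_coe, hspan, finrank_top] at this
    exact this.symm
  have hc : Continuous fun t => fun x : b => v t (g x) := continuous_pi fun x => hv _
  filter_upwards [hc.continuousAt.eventually hli'.eventually] with t ht
  have := ht.span_eq_top_of_card_eq_finrank' hcard
  rw [eq_top_iff, ← this]
  exact Submodule.span_mono (by rintro _ ⟨x, rfl⟩; exact ⟨g x, rfl⟩)

/-- The span of all matrices obtained from the product of the list `L` by replacing one
factor by a Toeplitz matrix. -/
def productTangent {n : ℕ} (L : List (Matrix (Fin n) (Fin n) ℂ)) :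
    Submodule ℂ (Matrix (Fin n) (Fin n) ℂ) :=
  Submodule.span ℂ {M | ∃ i < L.length, ∃ Y, IsToeplitz Y ∧
    M = (L.take i).prod * Y * (L.drop (i + 1)).prod}

/-- Subtract the tangent vectors with Y in places i and i + 1. When both factors are close to 1, the
zeroth-order terms Y cancel and the first-order behaviour becomes visible. -/
theorem mem_productTangent_of_commutator {n : ℕ} (L : List (Matrix (Fin n) (Fin n) ℂ)) (i : ℕ)
    (hi : i + 1 < L.length) (Y : Matrix (Fin n) (Fin n) ℂ) (hY : IsToeplitz Y) :
    (L.take i).prod * (Y * L[i + 1] - L[i] * Y) * (L.drop (i + 2)).prod ∈ productTangent L := by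
  have h1 : (L.take i).prod * Y * (L.drop (i + 1)).prod ∈ productTangent L :=
    Submodule.subset_span ⟨i, by omega, Y, hY, rfl⟩
  have h2 : (L.take (i + 1)).prod * Y * (L.drop (i + 2)).prod ∈ productTangent L :=
    Submodule.subset_span ⟨i + 1, hi, Y, hY, rfl⟩
  have := Submodule.sub_mem _ h1 h2
  rw [List.prod_take_succ _ _ (by omega), List.drop_eq_getElem_cons hi, List.prod_cons] at this
  convert this using 1
  noncomm_ring

/-- A list of Toeplitz matrices degenerating to identity matrices as `t → 0`, each factor
faster than the preceding one. -/
def deformedIdentities (n r : ℕ) (t : ℂ) : List (Matrix (Fin n) (Fin n) ℂ) :=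
  (List.range r).map fun j => 1 + t ^ (j + 1) • swapShift n (j + 1)

theorem exists_productTangent_deformedIdentities_eq_top (n : ℕ) :
    ∃ t, productTangent (deformedIdentities n (n / 2 + 1) t) = ⊤ := by
  let _ : NormedAddCommGroup (Matrix (Fin n) (Fin n) ℂ) := Matrix.linftyOpNormedAddCommGroup
  let _ : NormedSpace ℂ (Matrix (Fin n) (Fin n) ℂ) := Matrix.linftyOpNormedSpace
  set k := n / 2 with hk
  let L := deformedIdentities n (k + 1)
  have hlen : ∀ t, (L t).length = k + 1 := fun t => by simp [L, deformedIdentities]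
  have hget : ∀ t j (hj : j < (L t).length),
      (L t)[j] = 1 + t ^ (j + 1) • swapShift n (j + 1) := fun t j hj => by
    simp [L, deformedIdentities]
  have htake : ∀ i, Continuous fun t => ((L t).take i).prod := fun i => by
    simp only [L, deformedIdentities, ← List.map_take]
    exact continuous_list_prod _ fun j _ => by fun_prop
  have hdrop : ∀ i, Continuous fun t => ((L t).drop i).prod := fun i => by
    simp only [L, deformedIdentities, ← List.map_drop]
    exact continuous_list_prod _ fun j _ => by fun_prop
  have htake0 : ∀ i, ((L 0).take i).prod = 1 := fun i => by
    simp [L, deformedIdentities]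
  have hdrop0 : ∀ i, ((L 0).drop i).prod = 1 := fun i => by
    simp [L, deformedIdentities]
  -- For index i < k these are the differences of adjacent tangent vectors divided by t^(i+1), which
  -- stay continuous at t = 0 with value -S_{i+1} Y. The last index supplies the Toeplitz matrices
  -- themselves.
  let v : ℂ → Fin (k + 1) × {Y : Matrix (Fin n) (Fin n) ℂ // IsToeplitz Y} →
      Matrix (Fin n) (Fin n) ℂ := fun t x =>
    if (x.1 : ℕ) < k then
      ((L t).take x.1).prod * (t • (x.2.1 * swapShift n (x.1 + 2)) - swapShift n (x.1 + 1) * x.2.1) *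
        ((L t).drop (x.1 + 2)).prod
    else ((L t).take x.1).prod * x.2.1 * ((L t).drop (x.1 + 1)).prod
  have hv : ∀ x, Continuous fun t => v t x := fun x => by
    simp only [v]
    split_ifs
    · exact ((htake _).mul (by fun_prop)).mul (hdrop _)
    · exact ((htake _).mul (by fun_prop)).mul (hdrop _)
  have h0 : Submodule.span ℂ (Set.range (v 0)) = ⊤ := by
    refine eq_top_of_isToeplitz_of_swapShift _ (fun Y hY => ?_) fun m hm hmn Y hY => ?_
    · refine Submodule.subset_span ⟨(Fin.last k, ⟨Y, hY⟩), ?_⟩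
      simp [v, htake0, hdrop0]
    · rw [← Submodule.neg_mem_iff]
      refine Submodule.subset_span ⟨(⟨m - 1, by omega⟩, ⟨Y, hY⟩), ?_⟩
      have : m - 1 < k := by omega
      simp [v, htake0, hdrop0, this, Nat.sub_add_cancel hm]
  have hev := eventually_span_eq_top v hv h0
  -- A nonzero t is needed to undo the division by t^(i+1).
  obtain ⟨t, ht, ht0⟩ := ((hev.filter_mono nhdsWithin_le_nhds).and
    (self_mem_nhdsWithin : {(0 : ℂ)}ᶜ ∈ 𝓝[≠] (0 : ℂ))).exists
  refine ⟨t, ?_⟩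
  rw [eq_top_iff, ← ht, Submodule.span_le]
  rintro _ ⟨⟨i, Y, hY⟩, rfl⟩
  simp only [v, SetLike.mem_coe]
  split_ifs with hi
  · have := mem_productTangent_of_commutator (L t) i (by rw [hlen]; omega) Y hY
    rw [hget, hget] at this
    have hs : Y * (1 + t ^ (i + 1 + 1 : ℕ) • swapShift n (i + 1 + 1)) -
        (1 + t ^ (i + 1 : ℕ) • swapShift n (i + 1)) * Y =
        t ^ (i + 1 : ℕ) • (t • (Y * swapShift n (i + 2)) - swapShift n (i + 1) * Y) := by
      simp only [mul_add, add_mul, mul_one, one_mul, smul_sub, smul_smul, mul_smul_comm,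
        smul_mul_assoc, ← pow_succ]
      abel
    rw [hs, mul_smul_comm, smul_mul_assoc] at this
    exact (Submodule.smul_mem_iff _ (pow_ne_zero _ ht0)).1 this
  · exact Submodule.subset_span ⟨i, by rw [hlen]; exact i.2, Y, hY, rfl⟩

end ProductTangent

/-! ### Dominant polynomial maps -/

section Dominance

open Filter Topology MvPolynomial

/-- A neighbourhood contains a product of infinite sets, on which only the zero polynomial vanishes.
-/
theorem MvPolynomial.eq_zero_of_eventually_eval_eq_zero {ι : Type*}
    (p : MvPolynomial ι ℂ) (y : ι → ℂ) (h : ∀ᶠ z in 𝓝 y, eval z p = 0) : p = 0 := by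
  rw [nhds_pi, Filter.Eventually, Filter.mem_pi] at h
  obtain ⟨I, -, s, hs, hsub⟩ := h
  refine funext_set s (fun i => infinite_of_mem_nhds (y i) (hs i)) fun z hz => ?_
  rw [map_zero]
  exact hsub fun i _ => hz i trivial

theorem MvPolynomial.dense_eval_ne_zero {ι : Type*} (p : MvPolynomial ι ℂ) (hp : p ≠ 0) :
    Dense {z : ι → ℂ | eval z p ≠ 0} := by
  rw [dense_iff_inter_open]
  intro U hU ⟨y, hy⟩
  by_contra hempty
  refine hp (eq_zero_of_eventually_eval_eq_zero p y ?_)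
  filter_upwards [hU.mem_nhds hy] with z hz
  by_contra hne
  exact hempty ⟨z, hz, hne⟩

/-- If a polynomial map between affine spaces over `ℂ` is dominant, then its image contains
the complement of a hypersurface. -/
theorem MvPolynomial.exists_ne_zero_forall_eval_ne_zero {σ ι : Type*} [Finite σ] [Finite ι]
    (F : ι → MvPolynomial σ ℂ)
    (hF : ∀ p : MvPolynomial ι ℂ, aeval F p = 0 → p = 0) :
    ∃ p : MvPolynomial ι ℂ, p ≠ 0 ∧
      ∀ y : ι → ℂ, eval y p ≠ 0 → ∃ x : σ → ℂ, ∀ i, eval x (F i) = y i := by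
  let φ : MvPolynomial ι ℂ →+* MvPolynomial σ ℂ := (aeval F : MvPolynomial ι ℂ →ₐ[ℂ] _).toRingHom
  have hfp : φ.FinitePresentation := by
    rw [← RingHom.FinitePresentation.of_finiteType]
    refine RingHom.FiniteType.of_comp_finiteType (f := (algebraMap ℂ (MvPolynomial ι ℂ))) ?_
    have : φ.comp (algebraMap ℂ (MvPolynomial ι ℂ)) = algebraMap ℂ (MvPolynomial σ ℂ) :=
      (aeval F : MvPolynomial ι ℂ →ₐ[ℂ] MvPolynomial σ ℂ).comp_algebraMap
    rw [this, RingHom.finiteType_algebraMap]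
    infer_instance
  obtain ⟨D, hD⟩ := PrimeSpectrum.exists_constructibleSetData_iff.2
    (PrimeSpectrum.isConstructible_range_comap hfp)
  -- The range is constructible by Chevalley's theorem and contains the generic point because `φ` is
  -- injective. The piece containing that point has all its closed equations zero, so it is the
  -- basic open set of `C.f`.
  have hbot : (⊥ : PrimeSpectrum (MvPolynomial ι ℂ)) ∈ Set.range (PrimeSpectrum.comap φ) := by
    refine ⟨⊥, PrimeSpectrum.ext ?_⟩
    change Ideal.comap φ ⊥ = ⊥
    exact (RingHom.ker_eq_bot_iff_eq_zero φ).2 hF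
  rw [← hD, PrimeSpectrum.ConstructibleSetData.toSet, Set.mem_iUnion₂] at hbot
  obtain ⟨C, hC, hC1, hC2⟩ := hbot
  rw [PrimeSpectrum.mem_zeroLocus] at hC1 hC2
  have hg : ∀ i, C.g i = 0 := fun i => by
    have := hC1 (Set.mem_range_self i)
    simpa using this
  refine ⟨C.f, fun h => hC2 (by simp [h]), fun y hy => ?_⟩
  have hmem : pointToPoint (k := ℂ) y ∈ Set.range (PrimeSpectrum.comap φ) := by
    rw [← hD, PrimeSpectrum.ConstructibleSetData.toSet, Set.mem_iUnion₂]
    refine ⟨C, hC, ?_, ?_⟩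
    · rw [PrimeSpectrum.mem_zeroLocus]
      rintro _ ⟨i, rfl⟩
      rw [hg i]
      exact Ideal.zero_mem _
    · rw [PrimeSpectrum.mem_zeroLocus, Set.singleton_subset_iff]
      intro h
      exact hy ((mem_vanishingIdeal_singleton_iff y C.f).1 h)
  obtain ⟨Q, hQ⟩ := hmem
  -- The prime over y need not be a closed point, but any maximal ideal above it still contains the
  -- images of X i - y i, and the Nullstellensatz makes it a point x.
  obtain ⟨M, hM, hQM⟩ := Ideal.exists_le_maximal Q.asIdeal Q.isPrime.ne_top
  obtain ⟨x, hx⟩ := eq_vanishingIdeal_singleton_of_isMaximal ℂ hM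
  refine ⟨x, fun i => ?_⟩
  have h1 : X i - MvPolynomial.C (y i) ∈ (PrimeSpectrum.comap φ Q).asIdeal := by
    rw [hQ]
    exact (mem_vanishingIdeal_singleton_iff y _).2 (by simp)
  have h2 : φ (X i - MvPolynomial.C (y i)) ∈ M := hQM h1
  rw [hx, mem_vanishingIdeal_singleton_iff] at h2
  simpa [φ, sub_eq_zero, ← algebraMap_eq] using h2

end Dominance

/-! ### Generic and invertible matrices as Toeplitz products -/

section ToeplitzProducts

open Filter Topology Pointwise

/-- The Toeplitz matrix with prescribed diagonals. -/
def toeplitzOfDiagonals {R : Type*} (n : ℕ) (τ : Fin (2 * n) → R) : Matrix (Fin n) (Fin n) R :=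
  -- The index n + j - i runs over 1, ..., 2n - 1; slot 0 is never read.
  Matrix.of fun i j => τ ⟨n + j - i, by omega⟩

theorem isToeplitz_toeplitzOfDiagonals (n : ℕ) (τ : Fin (2 * n) → ℂ) :
    IsToeplitz (toeplitzOfDiagonals n τ) := by
  intro i j i' j' h
  have : n + (j : ℕ) - i = n + j' - i' := by omega
  simp only [toeplitzOfDiagonals, Matrix.of_apply, this]

theorem IsToeplitz.exists_toeplitzOfDiagonals {n : ℕ} {A : Matrix (Fin n) (Fin n) ℂ}
    (hA : IsToeplitz A) : ∃ τ, toeplitzOfDiagonals n τ = A := by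
  classical
  refine ⟨fun d => if h : ∃ p : Fin n × Fin n, n + (p.2 : ℕ) - p.1 = d then
    A h.choose.1 h.choose.2 else 0, ?_⟩
  ext i j
  have h : ∃ p : Fin n × Fin n, n + (p.2 : ℕ) - p.1 = n + j - i := ⟨(i, j), rfl⟩
  simp only [toeplitzOfDiagonals, Matrix.of_apply]
  rw [dif_pos h]
  have := h.choose_spec
  exact hA _ _ _ _ (by omega)

/-- The product of `r` Toeplitz matrices, as a function of their diagonals. -/
def toeplitzProduct {R : Type*} [CommRing R] (n r : ℕ) (x : Fin r × Fin (2 * n) → R) :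
    Matrix (Fin n) (Fin n) R :=
  ((List.finRange r).map fun k => toeplitzOfDiagonals n fun d => x (k, d)).prod

theorem toeplitzProduct_mem_pow (n r : ℕ) (x : Fin r × Fin (2 * n) → ℂ) :
    toeplitzProduct n r x ∈ {T : Matrix (Fin n) (Fin n) ℂ | IsToeplitz T} ^ r := by
  refine Set.mem_pow.2 ⟨fun k => ⟨_, isToeplitz_toeplitzOfDiagonals n fun d => x (k, d)⟩, ?_⟩
  rw [toeplitzProduct, List.ofFn_eq_map]

theorem map_toeplitzProduct {R S : Type*} [CommRing R] [CommRing S] (φ : R →+* S) (n r : ℕ)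
    (x : Fin r × Fin (2 * n) → R) :
    (toeplitzProduct n r x).map φ = toeplitzProduct n r (φ ∘ x) := by
  change φ.mapMatrix (toeplitzProduct n r x) = _
  rw [toeplitzProduct, map_list_prod, List.map_map]
  rfl

/-- A product of `r` independent values of a linear map is an open map near a point at which
the partial derivatives span the target. -/
theorem map_nhds_list_prod_eq {𝔸 ι : Type*} [NormedRing 𝔸] [NormedAlgebra ℂ 𝔸]
    [FiniteDimensional ℂ 𝔸] [Fintype ι] (r : ℕ) (ℓ : (ι → ℂ) →ₗ[ℂ] 𝔸) (x₀ : Fin r × ι → ℂ)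
    (L : List 𝔸) (hL : L = (List.finRange r).map fun k => ℓ fun d => x₀ (k, d))
    (h : Submodule.span ℂ {M | ∃ i < r, ∃ y, M = (L.take i).prod * ℓ y * (L.drop (i + 1)).prod} = ⊤) :
    map (fun x : Fin r × ι → ℂ => ((List.finRange r).map fun k => ℓ fun d => x (k, d)).prod) (𝓝 x₀) =
      𝓝 ((List.finRange r).map fun k => ℓ fun d => x₀ (k, d)).prod := by
  have : CompleteSpace 𝔸 := FiniteDimensional.complete ℂ 𝔸
  let ℓ' : Fin r → (Fin r × ι → ℂ) →L[ℂ] 𝔸 := fun k =>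
    LinearMap.toContinuousLinearMap (ℓ ∘ₗ LinearMap.funLeft ℂ ℂ fun d => (k, d))
  have hℓ' : ∀ k x, ℓ' k x = ℓ fun d => x (k, d) := fun _ _ => rfl
  have hd := HasStrictFDerivAt.list_prod' (𝕜 := ℂ) (l := List.finRange r) (x := x₀)
    (f := fun k x => ℓ' k x) (f' := ℓ') fun k _ => (ℓ' k).hasStrictFDerivAt
  refine hd.map_nhds_eq_of_surj ?_
  rw [eq_top_iff, ← h, Submodule.span_le]
  rintro _ ⟨i, hi, y, rfl⟩
  -- The direction that varies factor i alone leaves one term of the Leibniz sum.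
  refine ⟨fun p => if p.1 = ⟨i, hi⟩ then y p.2 else 0, ?_⟩
  simp only [ContinuousLinearMap.coe_coe, sum_apply, smul_apply, List.map_take, List.map_drop, hℓ',
    ← hL, smul_eq_mul, MulOpposite.smul_eq_mul_unop, MulOpposite.unop_op]
  rw [Finset.sum_eq_single (⟨i, by simpa using hi⟩ : Fin (List.finRange r).length)]
  · simp [mul_assoc]
  · intro j _ hj
    have hne : (List.finRange r)[j] ≠ ⟨i, hi⟩ := by
      intro h
      apply hj
      ext
      simpa using congrArg Fin.val h
    have h0 : (ℓ fun _ => 0) = 0 := map_zero ℓ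
    simp only [hne, if_false, h0, zero_mul, mul_zero]
  · simp

theorem exists_map_nhds_toeplitzProduct (n : ℕ) :
    ∃ x₀ : Fin (n / 2 + 1) × Fin (2 * n) → ℂ,
      map (toeplitzProduct n (n / 2 + 1)) (𝓝 x₀) = 𝓝 (toeplitzProduct n (n / 2 + 1) x₀) := by
  obtain ⟨t, ht⟩ := exists_productTangent_deformedIdentities_eq_top n
  set r := n / 2 + 1
  have hT : ∀ k : Fin r, IsToeplitz
      (1 + t ^ ((k : ℕ) + 1) • swapShift n (k + 1) : Matrix (Fin n) (Fin n) ℂ) := by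
    intro k i j i' j' h
    have h1 : (i = j) ↔ (i' = j') := by simp only [Fin.ext_iff]; omega
    simp only [Matrix.add_apply, Matrix.smul_apply, Matrix.one_apply, h1,
      isToeplitz_swapShift n _ i j i' j' h]
  choose τ hτ using fun k => (hT k).exists_toeplitzOfDiagonals
  let ℓ : (Fin (2 * n) → ℂ) →ₗ[ℂ] Matrix (Fin n) (Fin n) ℂ :=
    { toFun := toeplitzOfDiagonals n
      map_add' := fun _ _ => rfl
      map_smul' := fun _ _ => rfl }
  have hL : deformedIdentities n r t = (List.finRange r).map fun k => ℓ fun d => τ k d := by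
    rw [deformedIdentities, ← List.map_coe_finRange_eq_range, List.map_map]
    exact List.map_congr_left fun k _ => (hτ k).symm
  let _ : NormedRing (Matrix (Fin n) (Fin n) ℂ) := Matrix.linftyOpNormedRing
  let _ : NormedAlgebra ℂ (Matrix (Fin n) (Fin n) ℂ) := Matrix.linftyOpNormedAlgebra
  refine ⟨fun p => τ p.1 p.2, map_nhds_list_prod_eq r ℓ _ _ hL ?_⟩
  rw [eq_top_iff, ← ht, productTangent]
  refine Submodule.span_mono ?_
  rintro _ ⟨i, hi, Y, hY, rfl⟩
  obtain ⟨y, rfl⟩ := hY.exists_toeplitzOfDiagonals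
  exact ⟨i, by simpa [deformedIdentities] using hi, y, rfl⟩

theorem exists_isOpen_dense_subset_pow_isToeplitz (n : ℕ) :
    ∃ U : Set (Matrix (Fin n) (Fin n) ℂ), IsOpen U ∧ Dense U ∧
      U ⊆ {T : Matrix (Fin n) (Fin n) ℂ | IsToeplitz T} ^ (n / 2 + 1) := by
  obtain ⟨x₀, hx₀⟩ := exists_map_nhds_toeplitzProduct n
  generalize n / 2 + 1 = r at *
  let F : Fin n × Fin n → MvPolynomial (Fin r × Fin (2 * n)) ℂ := fun p =>
    toeplitzProduct n r MvPolynomial.X p.1 p.2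
  have hF : ∀ x p, MvPolynomial.eval x (F p) = toeplitzProduct n r x p.1 p.2 := fun x p => by
    have := congrFun (congrFun (map_toeplitzProduct (MvPolynomial.eval x) n r MvPolynomial.X) p.1) p.2
    rw [Matrix.map_apply] at this
    rw [this]
    congr 1
    exact funext fun q => MvPolynomial.eval_X (f := x) q
  let e : Matrix (Fin n) (Fin n) ℂ ≃ₜ (Fin n × Fin n → ℂ) :=
    { toFun := fun M p => M p.1 p.2
      invFun := fun y => Matrix.of fun i j => y (i, j)
      left_inv := fun _ => rfl
      right_inv := fun _ => rfl
      continuous_toFun := continuous_pi fun p => continuous_id.matrix_elem p.1 p.2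
      continuous_invFun := continuous_matrix fun i j => continuous_apply (i, j) }
  -- A polynomial relation among the entries vanishes on the image, which contains a neighbourhood
  -- of the product at `x₀`, so it is trivial.
  obtain ⟨p, hp, hpF⟩ := MvPolynomial.exists_ne_zero_forall_eval_ne_zero F (fun p hp => by
    refine p.eq_zero_of_eventually_eval_eq_zero (e (toeplitzProduct n r x₀)) ?_
    rw [← e.map_nhds_eq, ← hx₀, eventually_map, eventually_map]
    refine Eventually.of_forall fun x => ?_
    have := congrArg (MvPolynomial.aeval x) hp
    rw [map_zero, MvPolynomial.comp_aeval_apply] at this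
    simp only [MvPolynomial.aeval_eq_eval, hF] at this
    exact this)
  refine ⟨e ⁻¹' {y | MvPolynomial.eval y p ≠ 0}, ?_, ?_, fun M hM => ?_⟩
  · exact (isOpen_ne_fun (MvPolynomial.continuous_eval p) continuous_const).preimage e.continuous
  · exact (p.dense_eval_ne_zero hp).preimage e.isOpenMap
  · obtain ⟨x, hx⟩ := hpF _ hM
    have : toeplitzProduct n r x = M := by
      ext i j
      rw [← hF x (i, j), hx]
      rfl
    rw [← this]
    exact toeplitzProduct_mem_pow n r x

/-- Choose an invertible z in U. For X close to A z⁻¹ the matrix X⁻¹ A is close to z, hence in U; by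
density X can also be taken in U, and A = X (X⁻¹ A). -/
theorem mem_pow_isToeplitz_of_isUnit {n : ℕ} {A : Matrix (Fin n) (Fin n) ℂ} (hA : IsUnit A) :
    A ∈ {T : Matrix (Fin n) (Fin n) ℂ | IsToeplitz T} ^ (2 * (n / 2 + 1)) := by
  obtain ⟨U, hUo, hUd, hU⟩ := exists_isOpen_dense_subset_pow_isToeplitz n
  let _ : NormedRing (Matrix (Fin n) (Fin n) ℂ) := Matrix.linftyOpNormedRing
  let _ : NormedAlgebra ℂ (Matrix (Fin n) (Fin n) ℂ) := Matrix.linftyOpNormedAlgebra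
  obtain ⟨Z, hZu, hZ⟩ := hUd.inter_open_nonempty {M | IsUnit M} Units.isOpen ⟨1, isUnit_one⟩
  obtain ⟨z, rfl⟩ := hZu
  obtain ⟨a, rfl⟩ := hA
  have hc : ContinuousAt (fun M : Matrix (Fin n) (Fin n) ℂ => Ring.inverse M * (a : Matrix (Fin n) (Fin n) ℂ))
      ((a * z⁻¹ : (Matrix (Fin n) (Fin n) ℂ)ˣ) : Matrix (Fin n) (Fin n) ℂ) :=
    (NormedRing.inverse_continuousAt (a * z⁻¹)).mul continuousAt_const
  have hval : Ring.inverse ((a * z⁻¹ : (Matrix (Fin n) (Fin n) ℂ)ˣ) : Matrix (Fin n) (Fin n) ℂ) *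
      (a : Matrix (Fin n) (Fin n) ℂ) = z := by
    rw [Ring.inverse_unit, ← Units.val_mul]
    simp
  have hev := (hc.eventually (hval.symm ▸ hUo.mem_nhds hZ)).and
    (Units.isOpen.mem_nhds (a * z⁻¹).isUnit)
  obtain ⟨X, hXU, hX, hXu⟩ :=
    ((mem_closure_iff_frequently.1 (hUd _)).and_eventually hev).exists
  rw [two_mul, pow_add]
  refine Set.mem_mul.2 ⟨X, hU hXU, _, hU hX, ?_⟩
  rw [← mul_assoc, Ring.mul_inverse_cancel _ hXu, one_mul]

end ToeplitzProducts

/-! ### Reduction of arbitrary rank to invertible factors -/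

section RankReduction

open Pointwise Matrix

/-- The shift by n - k has exactly k ones, joining the first k rows to the last k columns. The row
bijection therefore puts the identity block first and the column bijection, through `Equiv.sumComm`,
puts it last. -/
theorem submatrix_shiftMatrix_eq {n k : ℕ} (e : Fin n ≃ Fin k ⊕ Fin (Fintype.card (Fin n) - k))
    (hk : k ≤ n) :
    ∃ σ τ : Fin n ≃ Fin n, (fromBlocks 1 0 0 0).submatrix e e =
      (shiftMatrix n (n - k)).submatrix σ τ := by
  have hc : Fintype.card (Fin n) = n := Fintype.card_fin n
  have h1 : k + (Fintype.card (Fin n) - k) = n := by omega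
  have h2 : (Fintype.card (Fin n) - k) + k = n := by omega
  refine ⟨e.trans (finSumFinEquiv.trans (finCongr h1)),
    e.trans ((Equiv.sumComm _ _).trans (finSumFinEquiv.trans (finCongr h2))), ?_⟩
  ext i j
  simp only [submatrix_apply, shiftMatrix_apply, Equiv.trans_apply]
  rcases e i with a | a <;> rcases e j with b | b <;> simp [Matrix.one_apply, Fin.ext_iff] <;>
    first
    | omega
    | (have := a.2; have := b.2; congr 1; rw [eq_iff_iff]; omega)

theorem exists_isUnit_mul_shiftMatrix_mul {n : ℕ} (A : Matrix (Fin n) (Fin n) ℂ) :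
    ∃ P Q : Matrix (Fin n) (Fin n) ℂ, ∃ d, IsUnit P ∧ IsUnit Q ∧ A = P * shiftMatrix n d * Q := by
  obtain ⟨V, U, e, hV, hU, h⟩ := A.exists_rank_normal_form
  obtain ⟨σ, τ, hst⟩ := submatrix_shiftMatrix_eq e (by simpa using A.rank_le_card_width)
  rw [hst] at h
  obtain ⟨v, rfl⟩ := hV
  obtain ⟨u, rfl⟩ := hU
  have hperm : (shiftMatrix n (n - A.rank)).submatrix σ τ =
      (1 : Matrix (Fin n) (Fin n) ℂ).submatrix σ (Equiv.refl _) * shiftMatrix n (n - A.rank) *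
        (1 : Matrix (Fin n) (Fin n) ℂ).submatrix (Equiv.refl _) τ := by
    ext i j
    simp [Matrix.mul_apply, Matrix.one_apply]
  have hunit : ∀ α β : Fin n ≃ Fin n, IsUnit ((1 : Matrix (Fin n) (Fin n) ℂ).submatrix α β) :=
    fun α β => (isUnit_submatrix_equiv α β).2 isUnit_one
  refine ⟨(v⁻¹ : (Matrix (Fin n) (Fin n) ℂ)ˣ) * (1 : Matrix (Fin n) (Fin n) ℂ).submatrix σ (Equiv.refl _),
    (1 : Matrix (Fin n) (Fin n) ℂ).submatrix (Equiv.refl _) τ * (u⁻¹ : (Matrix (Fin n) (Fin n) ℂ)ˣ),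
    n - A.rank, v⁻¹.isUnit.mul (hunit _ _), (hunit _ _).mul u⁻¹.isUnit, ?_⟩
  have : A = (v⁻¹ : (Matrix (Fin n) (Fin n) ℂ)ˣ) * (v * A * u) * (u⁻¹ : (Matrix (Fin n) (Fin n) ℂ)ˣ) := by
    simp [mul_assoc]
  rw [h, hperm] at this
  simpa only [mul_assoc] using this

theorem mem_pow_isToeplitz {n : ℕ} (A : Matrix (Fin n) (Fin n) ℂ) :
    A ∈ {T : Matrix (Fin n) (Fin n) ℂ | IsToeplitz T} ^ (4 * (n / 2 + 1) + 1) := by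
  obtain ⟨P, Q, d, hP, hQ, rfl⟩ := exists_isUnit_mul_shiftMatrix_mul A
  have : 4 * (n / 2 + 1) + 1 = 2 * (n / 2 + 1) + 1 + 2 * (n / 2 + 1) := by ring
  rw [this, pow_add, pow_add, pow_one]
  exact Set.mul_mem_mul (Set.mul_mem_mul (mem_pow_isToeplitz_of_isUnit hP)
    (isToeplitz_shiftMatrix n d)) (mem_pow_isToeplitz_of_isUnit hQ)

end RankReduction

/-! ### From Toeplitz to Hankel products -/

section Hankel

open Pointwise

/-- The exchange matrix, with ones on the main reverse diagonal. -/
def exchangeMatrix (n : ℕ) : Matrix (Fin n) (Fin n) ℂ :=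
  (1 : Matrix (Fin n) (Fin n) ℂ).submatrix Fin.rev id

theorem exchangeMatrix_mul {n : ℕ} (A : Matrix (Fin n) (Fin n) ℂ) :
    exchangeMatrix n * A = A.submatrix Fin.rev id := by
  ext i j
  simp [exchangeMatrix, Matrix.mul_apply, Matrix.one_apply]

theorem mul_exchangeMatrix {n : ℕ} (A : Matrix (Fin n) (Fin n) ℂ) :
    A * exchangeMatrix n = A.submatrix id Fin.rev := by
  ext i j
  simp [exchangeMatrix, Matrix.mul_apply, Matrix.one_apply, Fin.rev_eq_iff]

theorem exchangeMatrix_mul_self (n : ℕ) : exchangeMatrix n * exchangeMatrix n = 1 := by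
  rw [exchangeMatrix_mul]
  ext i j
  rw [Matrix.submatrix_apply, exchangeMatrix, Matrix.submatrix_apply, Fin.rev_rev]
  rfl

theorem IsToeplitz.isHankel_exchangeMatrix_mul {n : ℕ} {A : Matrix (Fin n) (Fin n) ℂ}
    (hA : IsToeplitz A) : IsHankel (exchangeMatrix n * A) := by
  intro i j i' j' h
  rw [exchangeMatrix_mul]
  refine hA _ _ _ _ ?_
  simp only [Fin.val_rev, id]
  omega

theorem IsToeplitz.isHankel_mul_exchangeMatrix {n : ℕ} {A : Matrix (Fin n) (Fin n) ℂ}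
    (hA : IsToeplitz A) : IsHankel (A * exchangeMatrix n) := by
  intro i j i' j' h
  rw [mul_exchangeMatrix]
  refine hA _ _ _ _ ?_
  simp only [Fin.val_rev, id]
  omega

/-- Since J² = 1, A B = (A J)(J B), and both factors are Hankel. -/
theorem pow_isToeplitz_two_subset (n : ℕ) :
    {T : Matrix (Fin n) (Fin n) ℂ | IsToeplitz T} ^ 2 ⊆ {H | IsHankel H} ^ 2 := by
  rw [sq, sq]
  rintro _ ⟨A, hA, B, hB, rfl⟩
  refine ⟨A * exchangeMatrix n, hA.isHankel_mul_exchangeMatrix, exchangeMatrix n * B,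
    hB.isHankel_exchangeMatrix_mul, ?_⟩
  simp only
  rw [mul_assoc, ← mul_assoc (exchangeMatrix n), exchangeMatrix_mul_self, one_mul]

theorem mem_pow_isHankel {n : ℕ} (A : Matrix (Fin n) (Fin n) ℂ) :
    A ∈ {H : Matrix (Fin n) (Fin n) ℂ | IsHankel H} ^ (4 * (n / 2 + 1) + 1) := by
  -- The number of factors is odd, so pairing leaves one Toeplitz factor T; decomposing A J instead
  -- of A turns it into the Hankel matrix T J.
  have h := mem_pow_isToeplitz (A * exchangeMatrix n)
  have h4 : 4 * (n / 2 + 1) = 2 * (2 * (n / 2 + 1)) := by ring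
  rw [pow_succ, h4, pow_mul] at h ⊢
  obtain ⟨B, hB, T, hT, hBT⟩ := h
  refine ⟨B, Set.pow_subset_pow_left (pow_isToeplitz_two_subset n) hB, T * exchangeMatrix n,
    hT.isHankel_mul_exchangeMatrix, ?_⟩
  simp only at hBT ⊢
  rw [← mul_assoc, hBT, mul_assoc, exchangeMatrix_mul_self, mul_one]

end Hankel

theorem mainTheorem3 (n : ℕ) (A : Matrix (Fin n) (Fin n) ℂ) :
    (∃ T : Fin (4 * (n / 2 + 1) + 1) → Matrix (Fin n) (Fin n) ℂ,
      (∀ k, IsToeplitz (T k)) ∧ A = (List.ofFn T).prod) ∧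
    (∃ H : Fin (4 * (n / 2 + 1) + 1) → Matrix (Fin n) (Fin n) ℂ,
      (∀ k, IsHankel (H k)) ∧ A = (List.ofFn H).prod) := by
  obtain ⟨T, hT⟩ := Set.mem_pow.1 (mem_pow_isToeplitz A)
  obtain ⟨H, hH⟩ := Set.mem_pow.1 (mem_pow_isHankel A)
  exact ⟨⟨fun k => T k, fun k => (T k).2, hT.symm⟩, ⟨fun k => H k, fun k => (H k).2, hH.symm⟩⟩
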